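/- Let $\lambda\ge 0$, let $\boldsymbol\mu=(\mu_1,\mu_2,\ldots)$ be a probability distribution on $\{1,2,\ldots\}$, and let $U\sim\mathrm{CP}(\lambda,\boldsymbol\mu)$ have the compound Poisson distribution, that is, $U$ is distributed as $\sum_{j=1}^N X_j$, where $N$ is Poisson with mean $\lambda$, the $X_1,X_2,\ldots$ are i.i.d. with $\mathbb{P}(X_1=k)=\mu_k$, and $N$ is independent of $(X_j)$. Put $\lambda_j=\lambda\mu_j$ and $\theta_k=\sum_{j\ge1} j(j-1)\cdots(j-k)\lambda_j$. For $y\in\mathbb{Z}^+=\{0,1,2,\ldots\}$ let $h=I(\cdot\le y)$ and let $f_h:\mathbb{Z}^+\to\mathbb{R}$ be the bounded solution, with $f_h(0)=0$, of the Stein equation $$h(x)-\mathbb{E}h(U)=\sum_{j=1}^\infty j\lambda_j f_h(x+j)-xf_h(x),\qquad x\in\mathbb{Z}^+ .$$ Let $\mathcal{H}_K=\{I(\cdot\le y):y\in\mathbb{Z}^+\}$ and $$M_l^{(K)}=\sup_{h\in\mathcal{H}_K}\ \sup_{x\in\mathbb{Z}^+}|\Delta^l f_h(x)|,\qquad l=0,1,\qquad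 \Delta f(x)=f(x+1)-f(x).$$ Suppose that $\theta_1<\infty$ and $2\theta_1>\theta_0$, and let $$\delta=\frac{2\theta_1-\theta_0}{2\sqrt{\pi}\,\exp\{\tfrac32(2\theta_1-\theta_0)\}} .$$ Then, for each $h\in\mathcal{H}_K$, the bounded solution $f_h$ exists and is unique, and $$M_0^{(K)}\le 2\sqrt{\frac{2}{\delta}}\qquad\text{and}\qquad M_1^{(K)}\le\frac{1}{2\delta}\left[1+\log^+(\pi\delta)\right],$$ where $\log^+$ denotes the positive part of the natural logarithm. -/

import Mathlib

open MeasureTheory ProbabilityTheory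

open scoped NNReal ENNReal

noncomputable section

/-- The compound Poisson distribution `CP(lam, μ)`: the law of `X 0 + ⋯ + X (N - 1)`, where `N` is
Poisson with mean `lam`, the `X i` are i.i.d. with probability mass function `μ`, and `N` is
independent of the sequence `X`. -/
def compoundPoisson (lam : ℝ≥0) (μ : PMF ℕ) : Measure ℕ :=
  ((poissonMeasure lam).prod (Measure.infinitePi fun _ : ℕ => μ.toMeasure)).map
    fun q : ℕ × (ℕ → ℕ) => ∑ i ∈ Finset.range q.1, q.2 i

/-- The parameters `lam_j = lam * μ_j`. -/
def cpRate (lam : ℝ≥0) (μ : PMF ℕ) (j : ℕ) : ℝ :=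
  (lam : ℝ) * (μ j).toReal

/-- `θ_k = ∑_j j (j - 1) ⋯ (j - k) lam_j`; the falling factorial is `j.descFactorial (k + 1)`. -/
def cpTheta (lam : ℝ≥0) (μ : PMF ℕ) (k : ℕ) : ℝ :=
  ∑' j : ℕ, (j.descFactorial (k + 1) : ℝ) * cpRate lam μ j

/-- `f` is a bounded solution of the Stein equation
`h x - E h(U) = ∑_{j ≥ 1} j lam_j f (x + j) - x f x`, for all `x = 0, 1, 2, …`, where
`U ∼ CP(lam, μ)`. The value `f 0` does not enter the equation (its coefficient is always `0`) and
is normalised to be `0`. -/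
structure IsSteinSolution (lam : ℝ≥0) (μ : PMF ℕ) (h f : ℕ → ℝ) : Prop where
  zero : f 0 = 0
  bounded : ∃ C : ℝ, ∀ x, |f x| ≤ C
  summable : ∀ x, Summable fun j : ℕ => (j : ℝ) * cpRate lam μ j * f (x + j)
  stein : ∀ x, h x - ∫ n, h n ∂(compoundPoisson lam μ) =
    ∑' j : ℕ, (j : ℝ) * cpRate lam μ j * f (x + j) - (x : ℝ) * f x

/-- The function `f_h`: the bounded solution of the Stein equation for `h`. -/
def steinSolution (lam : ℝ≥0) (μ : PMF ℕ) (h : ℕ → ℝ) : ℕ → ℝ :=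
  Classical.epsilon (IsSteinSolution lam μ h)

/-- The class of test functions `I(· ≤ y)`, `y = 0, 1, 2, …`, of the Kolmogorov distance. -/
def kolmogorovClass : Set (ℕ → ℝ) :=
  Set.range fun y : ℕ => (Set.Iic y).indicator fun _ => (1 : ℝ)

/-- The Stein factor `M_l = sup_h sup_x |Δ^l f_h x|` for the Kolmogorov distance, as an extended
nonnegative real; `Δ f x = f (x + 1) - f x`. -/
def steinFactorK (l : ℕ) (lam : ℝ≥0) (μ : PMF ℕ) : ℝ≥0∞ :=
  ⨆ h ∈ kolmogorovClass, ⨆ x : ℕ, ENNReal.ofReal |(fwdDiff 1)^[l] (steinSolution lam μ h) x|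

end

/-! Write `A` for the generating function of the rates, `t = 2θ₁ - θ₀ = ∑ j(2j-3)λ_j`, and `w_u = 1
+ u(z-1)`. For `|z| = 1` the Stein equation with test function `z^x` is solved by `f(x+1) = ∫₀¹
(1-z) exp(A(z) - A(w_u)) w_u^x du`: the equation is the fundamental theorem of calculus for
`exp(A(z) - A(w_u)) w_u^x`, whose endpoint values are `z^x` and `E z^U` (`hasSum_steinTransform`).

Averaging over the circle against `∑_{k ≤ y} z^(-k)` turns `z^x` into `I(x ≤ y)`. The factor `1-z`
telescopes this kernel to norm at most 2, and `Re(A(z) - A(w_u)) ≤ t/2` (`re_genFun_sub_le`), so a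
solution bounded by `2 exp(t/2)` results. Bounded solutions are unique because the homogeneous
equation is a contraction for large `x`, so this is `f_h`.

Hence the two Stein factors are at most `2 exp(t/2)` and `4 exp(t/2)`. Elementary inequalities in
`t` show that these already lie below the stated bounds. -/

/-! ### Real part of the exponent along the segment from 1 to `z` -/

/-- The point at parameter `u`, clamped to `[0, 1]`, of the segment from `1` to `z`. -/
noncomputable def segmentPoint (z : ℂ) (u : ℝ) : ℂ := 1 + ((max 0 (min u 1) : ℝ) : ℂ) * (z - 1)

/-- The generating function `∑ a_j w ^ j` of a real sequence. -/
noncomputable def genFun (a : ℕ → ℝ) (w : ℂ) : ℂ := ∑' j, (a j : ℂ) * w ^ j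

lemma segmentPoint_of_mem {z : ℂ} {u : ℝ} (hu : u ∈ Set.Icc (0 : ℝ) 1) :
    segmentPoint z u = 1 + (u : ℂ) * (z - 1) := by
  simp [segmentPoint, hu.1, hu.2]

lemma norm_one_add_mul_sub_one_le {z : ℂ} (hz : ‖z‖ = 1) {u : ℝ} (hu : u ∈ Set.Icc (0 : ℝ) 1) :
    ‖1 + (u : ℂ) * (z - 1)‖ ≤ 1 := by
  have h : 1 + (u : ℂ) * (z - 1) = ((1 - u : ℝ) : ℂ) + (u : ℂ) * z := by push_cast; ring
  rw [h]
  refine (norm_add_le _ _).trans ?_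
  rw [norm_mul, hz, Complex.norm_real, Complex.norm_real, Real.norm_of_nonneg hu.1,
    Real.norm_of_nonneg (by linarith [hu.2])]
  linarith

lemma clamp_mem (u : ℝ) : max 0 (min u 1) ∈ Set.Icc (0 : ℝ) 1 :=
  ⟨le_max_left _ _, max_le zero_le_one (min_le_right _ _)⟩

/-- Clamping makes this hold for every real `u`, so later continuity and domination arguments need
no restriction to `[0, 1]`. -/
lemma norm_segmentPoint_le {z : ℂ} (hz : ‖z‖ = 1) (u : ℝ) : ‖segmentPoint z u‖ ≤ 1 :=
  norm_one_add_mul_sub_one_le hz (clamp_mem u)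

lemma norm_pow_mul_pow_sub_one_le {z w : ℂ} {d : ℝ} (hz : ‖z‖ ≤ 1) (hw : ‖w‖ ≤ 1)
    (hzd : ‖z - 1‖ ≤ d) (hwd : ‖w - 1‖ ≤ d) (i k : ℕ) :
    ‖z ^ i * w ^ k - 1‖ ≤ (i + k : ℕ) * d := by
  induction i with
  | zero =>
    induction k with
    | zero => simp
    | succ k ih =>
      have h : z ^ 0 * w ^ (k + 1) - 1 = w * (z ^ 0 * w ^ k - 1) + (w - 1) := by ring
      rw [h]
      refine (norm_add_le _ _).trans ?_
      rw [norm_mul]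
      have := mul_le_mul_of_nonneg_right hw (norm_nonneg (z ^ 0 * w ^ k - 1))
      push_cast at ih ⊢
      linarith
  | succ i ih =>
    have h : z ^ (i + 1) * w ^ k - 1 = z * (z ^ i * w ^ k - 1) + (z - 1) := by ring
    rw [h]
    refine (norm_add_le _ _).trans ?_
    rw [norm_mul]
    have := mul_le_mul_of_nonneg_right hz (norm_nonneg (z ^ i * w ^ k - 1))
    push_cast at ih ⊢
    linarith

lemma sq_norm_sub_one {z : ℂ} (hz : ‖z‖ = 1) : ‖z - 1‖ ^ 2 = 2 * (1 - z.re) := by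
  have h1 : z.re ^ 2 + z.im ^ 2 = 1 := by
    have := Complex.sq_norm z
    rw [hz, Complex.normSq_apply] at this
    linarith
  rw [Complex.sq_norm, Complex.normSq_apply]
  simp
  linarith

/-- Factor `z^j - w^j = (1-u)(z-1)S` with `S` a sum of `j` monomials close to 1. Replacing `S` by
`j` gives the main term `-j(1 - Re z)`; the error is at most `j(j-1)|z-1|² = 2j(j-1)(1 - Re z)`. -/
lemma re_pow_sub_pow_le {z : ℂ} (hz : ‖z‖ = 1) {u : ℝ} (hu : u ∈ Set.Icc (0 : ℝ) 1) (j : ℕ) :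
    (z ^ j - (1 + (u : ℂ) * (z - 1)) ^ j).re ≤
      (1 - u) * (1 - z.re) * ((j : ℝ) * (2 * j - 3)) := by
  set w : ℂ := 1 + (u : ℂ) * (z - 1) with hw
  rcases Nat.eq_zero_or_pos j with rfl | hj
  · simp
  have hw1 : ‖w‖ ≤ 1 := norm_one_add_mul_sub_one_le hz hu
  have hwd : ‖w - 1‖ ≤ ‖z - 1‖ := by
    have : w - 1 = (u : ℂ) * (z - 1) := by rw [hw]; ring
    rw [this, norm_mul, Complex.norm_real, Real.norm_of_nonneg hu.1]
    exact mul_le_of_le_one_left (norm_nonneg _) hu.2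
  set S : ℂ := ∑ i ∈ Finset.range j, z ^ i * w ^ (j - 1 - i) with hS
  have hgeom : z ^ j - w ^ j = ((1 - u : ℝ) : ℂ) * ((z - 1) * (S - j) + j * (z - 1)) := by
    rw [← (Commute.all z w).geom_sum₂_mul j, ← hS, hw]
    push_cast
    ring
  have hSj : ‖S - j‖ ≤ j * ((j - 1) * ‖z - 1‖) := by
    have : S - j = ∑ i ∈ Finset.range j, (z ^ i * w ^ (j - 1 - i) - 1) := by
      simp [hS, Finset.sum_sub_distrib]
    rw [this]
    refine (norm_sum_le_of_le _ (f := fun i => z ^ i * w ^ (j - 1 - i) - 1)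
      (n := fun _ => (j - 1) * ‖z - 1‖) fun i hi => ?_).trans (by simp)
    have hi' := Finset.mem_range.1 hi
    have h := norm_pow_mul_pow_sub_one_le hz.le hw1 le_rfl hwd i (j - 1 - i)
    have e : i + (j - 1 - i) = j - 1 := by omega
    rw [e, Nat.cast_pred hj] at h
    exact h
  have h1 : ((z - 1) * (S - j)).re ≤ 2 * (1 - z.re) * (j * (j - 1)) := by
    refine (Complex.re_le_norm _).trans ?_
    rw [norm_mul, ← sq_norm_sub_one hz]
    have := mul_le_mul_of_nonneg_left hSj (norm_nonneg (z - 1))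
    linarith
  have h2 : ((j : ℂ) * (z - 1)).re = -(j * (1 - z.re)) := by simp; ring
  rw [hgeom, Complex.re_ofReal_mul, Complex.add_re, h2, mul_assoc]
  refine mul_le_mul_of_nonneg_left ?_ (by linarith [hu.2])
  linarith

lemma re_pow_sub_pow_le_half {z : ℂ} (hz : ‖z‖ = 1) {u : ℝ} (hu : u ∈ Set.Icc (0 : ℝ) 1)
    {j : ℕ} (hj : 2 ≤ j) :
    (z ^ j - (1 + (u : ℂ) * (z - 1)) ^ j).re ≤ 1 / 2 * ((j : ℝ) * (2 * j - 3)) := by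
  rcases hj.eq_or_lt with rfl | hj
  · have h1 : z.re ^ 2 + z.im ^ 2 = 1 := by
      have := Complex.sq_norm z
      rw [hz, Complex.normSq_apply] at this
      linarith
    obtain ⟨hu0, hu1⟩ := hu
    have hx : z.re ^ 2 ≤ 1 := by nlinarith [sq_nonneg z.im]
    have key : (z ^ 2 - (1 + (u : ℂ) * (z - 1)) ^ 2).re =
        z.re ^ 2 - z.im ^ 2 - ((1 + u * (z.re - 1)) ^ 2 - (u * z.im) ^ 2) := by
      simp [pow_two]
    have hi : z.im ^ 2 = 1 - z.re ^ 2 := by linarith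
    rw [key, mul_pow, hi]
    push_cast
    have hu2 : u ^ 2 ≤ 1 := by nlinarith
    nlinarith [sq_nonneg (1 + u * (z.re - 1)), mul_nonneg (sub_nonneg.2 hu2) (sub_nonneg.2 hx)]
  -- For `j ≥ 3` the trivial bound 2 suffices, since `j(2j-3)/2 ≥ 9/2`.
  · have hw := norm_one_add_mul_sub_one_le hz hu
    have h1 : (z ^ j - (1 + (u : ℂ) * (z - 1)) ^ j).re ≤ 1 + 1 := by
      refine (Complex.re_le_norm _).trans ((norm_sub_le _ _).trans (add_le_add ?_ ?_))
      · simp [hz]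
      · rw [norm_pow]; exact pow_le_one₀ (norm_nonneg _) hw
    have h3 : (3 : ℝ) ≤ j := by exact_mod_cast hj
    nlinarith

/-- The multiplier must not depend on `j`: the weight `j(2j-3)` is negative at `j = 1`, so the sign
is usable only after summation, where the total is `t ≥ 0`. -/
lemma re_pow_sub_pow_le_min {z : ℂ} (hz : ‖z‖ = 1) {u : ℝ} (hu : u ∈ Set.Icc (0 : ℝ) 1) (j : ℕ) :
    (z ^ j - (1 + (u : ℂ) * (z - 1)) ^ j).re ≤
      min ((1 - u) * (1 - z.re)) (1 / 2) * ((j : ℝ) * (2 * j - 3)) := by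
  have h := re_pow_sub_pow_le hz hu j
  rcases lt_or_ge j 2 with hj | hj
  · interval_cases j
    · simp
    · have := min_le_left ((1 - u) * (1 - z.re)) (1 / 2)
      push_cast at h ⊢
      linarith
  · rcases min_choice ((1 - u) * (1 - z.re)) (1 / 2) with hc | hc <;> rw [hc]
    · exact h
    · exact re_pow_sub_pow_le_half hz hu hj

lemma norm_mul_pow_le {a : ℕ → ℝ} (ha : ∀ j, 0 ≤ a j) {w : ℂ} (hw : ‖w‖ ≤ 1) (j k : ℕ) :
    ‖(a j : ℂ) * w ^ k‖ ≤ a j := by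
  rw [norm_mul, Complex.norm_real, Real.norm_of_nonneg (ha j), norm_pow]
  exact mul_le_of_le_one_right (ha j) (pow_le_one₀ (norm_nonneg _) hw)

lemma summable_mul_pow {a : ℕ → ℝ} (ha : ∀ j, 0 ≤ a j) (hs : Summable a) {w : ℂ} (hw : ‖w‖ ≤ 1) :
    Summable fun j => (a j : ℂ) * w ^ j :=
  hs.of_norm_bounded fun j => norm_mul_pow_le ha hw j j

lemma re_genFun_sub_le {a : ℕ → ℝ} (ha : ∀ j, 0 ≤ a j) (hs : Summable a) {t : ℝ}
    (ht : HasSum (fun j : ℕ => (j : ℝ) * (2 * j - 3) * a j) t) (ht0 : 0 ≤ t)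
    {z : ℂ} (hz : ‖z‖ = 1) (u : ℝ) :
    (genFun a z - genFun a (segmentPoint z u)).re ≤ t / 2 := by
  have hsum := (summable_mul_pow ha hs hz.le).hasSum.sub
    (summable_mul_pow ha hs (norm_segmentPoint_le hz u)).hasSum
  have hre := Complex.hasSum_re hsum
  have hc := ht.mul_left (min ((1 - max 0 (min u 1)) * (1 - z.re)) (1 / 2))
  have h := hasSum_le (fun j => ?_) hre hc
  · refine h.trans ?_
    have := mul_le_mul_of_nonneg_right
      (min_le_right ((1 - max 0 (min u 1)) * (1 - z.re)) (1 / 2)) ht0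
    linarith
  · have := mul_le_mul_of_nonneg_left (re_pow_sub_pow_le_min hz (clamp_mem u) j) (ha j)
    have e : (a j : ℂ) * z ^ j - (a j : ℂ) * segmentPoint z u ^ j =
        (a j : ℂ) * (z ^ j - segmentPoint z u ^ j) := by ring
    rw [e, Complex.re_ofReal_mul]
    unfold segmentPoint
    linarith

lemma norm_exp_genFun_sub_le {a : ℕ → ℝ} (ha : ∀ j, 0 ≤ a j) (hs : Summable a) {t : ℝ}
    (ht : HasSum (fun j : ℕ => (j : ℝ) * (2 * j - 3) * a j) t) (ht0 : 0 ≤ t)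
    {z : ℂ} (hz : ‖z‖ = 1) (u : ℝ) :
    ‖Complex.exp (genFun a z - genFun a (segmentPoint z u))‖ ≤ Real.exp (t / 2) := by
  rw [Complex.norm_exp]
  exact Real.exp_le_exp.2 (re_genFun_sub_le ha hs ht ht0 hz u)

lemma continuous_genFun_comp {X : Type*} [TopologicalSpace X] {a : ℕ → ℝ} (ha : ∀ j, 0 ≤ a j)
    (hs : Summable a) {w : X → ℂ} (hw : Continuous w) (hw1 : ∀ x, ‖w x‖ ≤ 1) :
    Continuous fun x => genFun a (w x) :=
  continuous_tsum (fun j => by fun_prop) hs fun j x => norm_mul_pow_le ha (hw1 x) j j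

lemma continuous_segmentPoint : Continuous fun p : ℂ × ℝ => segmentPoint p.1 p.2 := by
  unfold segmentPoint
  fun_prop

lemma norm_geom_sum_inv_mul_le {z : ℂ} (hz : ‖z‖ = 1) (n : ℕ) :
    ‖(∑ k ∈ Finset.range n, z⁻¹ ^ k) * (1 - z)‖ ≤ 2 := by
  have hz0 : z ≠ 0 := by rintro rfl; simp at hz
  have e : (∑ k ∈ Finset.range n, z⁻¹ ^ k) * (1 - z) = (z⁻¹ ^ n - 1) * z := by
    rw [← geom_sum_mul, mul_assoc, sub_mul, inv_mul_cancel₀ hz0, one_mul]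
  rw [e, norm_mul, hz, mul_one]
  refine (norm_sub_le _ _).trans ?_
  simp [hz]
  norm_num

/-! ### The Stein equation for the test function `z ^ x` -/

lemma hasDerivAt_segment (z : ℂ) (u : ℝ) :
    HasDerivAt (fun v : ℝ => 1 + (v : ℂ) * (z - 1)) (z - 1) u := by
  simpa using ((Complex.ofRealCLM.hasDerivAt (x := u)).mul_const (z - 1)).const_add 1

lemma hasDerivAt_genFun_segment {a : ℕ → ℝ} (ha : ∀ j, 0 ≤ a j) (hs : Summable a)
    (hs1 : Summable fun j : ℕ => (j : ℝ) * a j) {z : ℂ} (hz : ‖z‖ = 1)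
    {u : ℝ} (hu : u ∈ Set.Ioo (0 : ℝ) 1) :
    HasDerivAt (fun v : ℝ => genFun a (1 + (v : ℂ) * (z - 1)))
      ((∑' j : ℕ, ((j * a j : ℝ) : ℂ) * (1 + (u : ℂ) * (z - 1)) ^ (j - 1)) * (z - 1)) u := by
  have hw : ∀ v ∈ Set.Ioo (0 : ℝ) 1, ‖1 + (v : ℂ) * (z - 1)‖ ≤ 1 := fun v hv =>
    norm_one_add_mul_sub_one_le hz (Set.Ioo_subset_Icc_self hv)
  rw [← tsum_mul_right]
  refine hasDerivAt_tsum_of_isPreconnected (t := Set.Ioo (0 : ℝ) 1)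
    (g := fun (j : ℕ) (v : ℝ) => (a j : ℂ) * (1 + (v : ℂ) * (z - 1)) ^ j)
    (g' := fun (j : ℕ) (v : ℝ) => ((j * a j : ℝ) : ℂ) * (1 + (v : ℂ) * (z - 1)) ^ (j - 1) * (z - 1))
    (u := fun j : ℕ => (j * a j) * ‖z - 1‖)
    (hs1.mul_right _) isOpen_Ioo isPreconnected_Ioo (fun j v hv => ?_) (fun j v hv => ?_) hu
    (summable_mul_pow ha hs (hw u hu)) hu
  · have := ((hasDerivAt_segment z v).pow j).const_mul (a j : ℂ)
    convert! this using 1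
    push_cast
    ring
  · rw [norm_mul]
    exact mul_le_mul_of_nonneg_right
      (norm_mul_pow_le (a := fun j : ℕ => (j : ℝ) * a j) (fun j => by have := ha j; positivity)
        (hw v hv) j (j - 1)) (norm_nonneg _)

/-- The integrand of the solution of the Stein equation for the test function `z ^ ·`. -/
noncomputable def steinIntegrand (a : ℕ → ℝ) (x : ℕ) (z : ℂ) (u : ℝ) : ℂ :=
  (1 - z) * Complex.exp (genFun a z - genFun a (segmentPoint z u)) * segmentPoint z u ^ x

/-- The value at `x + 1` of the solution of the Stein equation for the test function `z ^ ·`. -/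
noncomputable def steinTransform (a : ℕ → ℝ) (x : ℕ) (z : ℂ) : ℂ :=
  ∫ u in (0 : ℝ)..1, steinIntegrand a x z u

lemma hasSum_intervalIntegral_mul_of_bounded {c : ℕ → ℝ} (hc : ∀ j, 0 ≤ c j) (hs : Summable c)
    {g : ℕ → ℝ → ℂ} (hg : ∀ j, Continuous (g j)) {B : ℝ} (hB : ∀ j u, ‖g j u‖ ≤ B) (p q : ℝ) :
    HasSum (fun j => (c j : ℂ) * ∫ u in p..q, g j u) (∫ u in p..q, ∑' j, (c j : ℂ) * g j u) := by
  have hn : ∀ j u, ‖(c j : ℂ) * g j u‖ ≤ c j * B := fun j u => by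
    rw [norm_mul, Complex.norm_real, Real.norm_of_nonneg (hc j)]
    exact mul_le_mul_of_nonneg_left (hB j u) (hc j)
  simp_rw [← intervalIntegral.integral_const_mul]
  refine intervalIntegral.hasSum_integral_of_dominated_convergence (fun j _ => c j * B)
    (fun j => ((hg j).const_mul _).aestronglyMeasurable)
    (fun j => Filter.Eventually.of_forall fun u _ => hn j u)
    (Filter.Eventually.of_forall fun u _ => hs.mul_right B) intervalIntegrable_const
    (Filter.Eventually.of_forall fun u _ => ?_)
  exact ((hs.mul_right B).of_norm_bounded fun j => hn j u).hasSum

section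
variable {a : ℕ → ℝ} (ha : ∀ j, 0 ≤ a j) (hs : Summable a)
include ha hs

lemma continuous_steinIntegrand_comp {X : Type*} [TopologicalSpace X] {z : X → ℂ} {u : X → ℝ}
    (hz : Continuous z) (hu : Continuous u) (hz1 : ∀ p, ‖z p‖ = 1) (x : ℕ) :
    Continuous fun p => steinIntegrand a x (z p) (u p) := by
  have hw : Continuous fun p => segmentPoint (z p) (u p) :=
    continuous_segmentPoint.comp (hz.prodMk hu)
  have h1 := continuous_genFun_comp ha hs hz fun p => (hz1 p).le
  have h2 := continuous_genFun_comp ha hs hw fun p => norm_segmentPoint_le (hz1 p) (u p)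
  unfold steinIntegrand
  fun_prop

lemma continuous_steinTransform_comp {z : ℝ → ℂ} (hz : Continuous z) (hz1 : ∀ p, ‖z p‖ = 1)
    (x : ℕ) : Continuous fun p => steinTransform a x (z p) := by
  unfold steinTransform
  refine intervalIntegral.continuous_parametric_intervalIntegral_of_continuous' ?_ 0 1
  exact continuous_steinIntegrand_comp ha hs (hz.comp continuous_fst) continuous_snd
    (fun p => hz1 p.1) x

variable {t : ℝ} (ht : HasSum (fun j : ℕ => (j : ℝ) * (2 * j - 3) * a j) t) (ht0 : 0 ≤ t)
include ht ht0

lemma norm_steinIntegrand_le {z : ℂ} (hz : ‖z‖ = 1) (x : ℕ) (u : ℝ) :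
    ‖steinIntegrand a x z u‖ ≤ ‖1 - z‖ * Real.exp (t / 2) := by
  unfold steinIntegrand
  rw [norm_mul, norm_mul, norm_pow]
  refine (mul_le_of_le_one_right (by positivity)
    (pow_le_one₀ (norm_nonneg _) (norm_segmentPoint_le hz u))).trans ?_
  exact mul_le_mul_of_nonneg_left (norm_exp_genFun_sub_le ha hs ht ht0 hz u) (norm_nonneg _)

lemma norm_steinTransform_le {z : ℂ} (hz : ‖z‖ = 1) (x : ℕ) :
    ‖steinTransform a x z‖ ≤ ‖1 - z‖ * Real.exp (t / 2) := by
  have := intervalIntegral.norm_integral_le_of_norm_le_const (a := 0) (b := 1)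
    (f := steinIntegrand a x z) fun u _ => norm_steinIntegrand_le ha hs ht ht0 hz x u
  simpa [steinTransform] using this

lemma hasSum_steinTransform (hs1 : Summable fun j : ℕ => (j : ℝ) * a j) {z : ℂ} (hz : ‖z‖ = 1)
    (x : ℕ) :
    HasSum (fun j : ℕ => ((j * a j : ℝ) : ℂ) * steinTransform a (x + j - 1) z)
      (z ^ x - Complex.exp (genFun a z - genFun a 1) + x * steinTransform a (x - 1) z) := by
  have hc : ∀ j : ℕ, 0 ≤ (j : ℝ) * a j := fun j => by have := ha j; positivity
  have hg : ∀ k, Continuous (steinIntegrand a k z) := fun k =>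
    continuous_steinIntegrand_comp ha hs continuous_const continuous_id (fun _ => hz) k
  have hn : ∀ k u, ‖steinIntegrand a k z u‖ ≤ ‖1 - z‖ * Real.exp (t / 2) := fun k u =>
    norm_steinIntegrand_le ha hs ht ht0 hz k u
  have hsum := hasSum_intervalIntegral_mul_of_bounded hc hs1
    (g := fun j => steinIntegrand a (x + j - 1) z) (fun j => hg _) (fun j u => hn _ u) 0 1
  convert! hsum using 1
  have hcS : Continuous fun u => ∑' j : ℕ, ((j * a j : ℝ) : ℂ) * steinIntegrand a (x + j - 1) z u := by
    refine continuous_tsum (fun j => (hg _).const_mul _)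
      (hs1.mul_right (‖1 - z‖ * Real.exp (t / 2))) fun j u => ?_
    rw [norm_mul, Complex.norm_real, Real.norm_of_nonneg (hc j)]
    exact mul_le_mul_of_nonneg_left (hn _ u) (hc j)
  have hcH : Continuous fun u =>
      Complex.exp (genFun a z - genFun a (segmentPoint z u)) * segmentPoint z u ^ x := by
    have hw : Continuous fun u => segmentPoint z u :=
      continuous_segmentPoint.comp (continuous_const.prodMk continuous_id)
    have h2 := continuous_genFun_comp ha hs hw (norm_segmentPoint_le hz)
    fun_prop
  -- Differentiating the exponential produces the series over `j`; differentiating the power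
  -- produces the term with coefficient `x`.
  have hFTC := intervalIntegral.integral_eq_sub_of_hasDerivAt_of_le (zero_le_one (α := ℝ))
    (f := fun u : ℝ => Complex.exp (genFun a z - genFun a (1 + (u : ℂ) * (z - 1))) *
      (1 + (u : ℂ) * (z - 1)) ^ x)
    (f' := fun u => (∑' j : ℕ, ((j * a j : ℝ) : ℂ) * steinIntegrand a (x + j - 1) z u) -
      x * steinIntegrand a (x - 1) z u)
    (hcH.continuousOn.congr fun u hu => by simp only [segmentPoint_of_mem hu]) (fun u hu => ?_)
    ((hcS.sub ((hg _).const_mul _)).intervalIntegrable 0 1)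
  · rw [intervalIntegral.integral_sub (hcS.intervalIntegrable 0 1)
      (((hg _).const_mul _).intervalIntegrable 0 1), intervalIntegral.integral_const_mul] at hFTC
    simp only [Complex.ofReal_one, one_mul, add_sub_cancel, sub_self, Complex.exp_zero,
      Complex.ofReal_zero, zero_mul, add_zero, one_pow, mul_one] at hFTC
    unfold steinTransform
    rw [← hFTC]
    ring
  · have hw := segmentPoint_of_mem (z := z) (Set.Ioo_subset_Icc_self hu)
    have h := ((hasDerivAt_genFun_segment ha hs hs1 hz hu).const_sub (genFun a z)).cexp.mul
      ((hasDerivAt_segment z u).pow x)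
    convert! h using 1
    have e : ∀ j : ℕ, ((j * a j : ℝ) : ℂ) * steinIntegrand a (x + j - 1) z u =
        ((1 - z) * Complex.exp (genFun a z - genFun a (1 + (u : ℂ) * (z - 1))) *
          (1 + (u : ℂ) * (z - 1)) ^ x) *
          (((j * a j : ℝ) : ℂ) * (1 + (u : ℂ) * (z - 1)) ^ (j - 1)) := by
      intro j
      -- At `j = 0` the truncated exponents disagree, but the coefficient vanishes.
      rcases Nat.eq_zero_or_pos j with rfl | hj
      · simp
      · rw [Nat.add_sub_assoc hj, steinIntegrand, hw, pow_add]
        ring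
    simp_rw [e]
    rw [tsum_mul_left, steinIntegrand, hw]
    simp only [Pi.pow_apply]
    ring

end

/-! ### Fourier inversion on the unit circle -/

/-- The kernel `∑_{k ≤ y} z ^ (-k)` whose Fourier transform on the unit circle is `I(· ≤ y)`. -/
noncomputable def dirichletSum (y : ℕ) (z : ℂ) : ℂ := ∑ k ∈ Finset.range (y + 1), z⁻¹ ^ k

/-- The parametrization `φ ↦ exp (i φ)` of the unit circle. -/
noncomputable def unitCircle (φ : ℝ) : ℂ := Complex.exp (φ * Complex.I)

lemma norm_unitCircle (φ : ℝ) : ‖unitCircle φ‖ = 1 := Complex.norm_exp_ofReal_mul_I φ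

lemma continuous_unitCircle : Continuous unitCircle := by
  unfold unitCircle
  fun_prop

lemma continuous_dirichletSum (y : ℕ) : Continuous fun φ => dirichletSum y (unitCircle φ) := by
  unfold dirichletSum
  refine continuous_finsetSum _ fun k _ => Continuous.pow ?_ k
  exact continuous_unitCircle.inv₀ fun φ => Complex.exp_ne_zero _

lemma norm_dirichletSum_le (y : ℕ) (φ : ℝ) : ‖dirichletSum y (unitCircle φ)‖ ≤ y + 1 := by
  refine (norm_sum_le_of_le (n := fun _ => 1) _ fun k _ => ?_).trans (by simp)
  simp [norm_unitCircle]

lemma integral_exp_int_mul_I (m : ℤ) :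
    ∫ φ in (-Real.pi)..Real.pi, Complex.exp ((m * Complex.I) * φ) =
      if m = 0 then 2 * (Real.pi : ℂ) else 0 := by
  split_ifs with h
  · subst h
    simp
    ring
  · have hm : (m : ℂ) * Complex.I ≠ 0 := by simp [h]
    rw [integral_exp_mul_complex hm]
    have : (m : ℂ) * Complex.I * (Real.pi : ℂ) =
        (m : ℂ) * Complex.I * ((-Real.pi : ℝ) : ℂ) + m * (2 * Real.pi * Complex.I) := by
      push_cast; ring
    rw [this, Complex.exp_add, Complex.exp_int_mul_two_pi_mul_I]
    simp

lemma integral_dirichletSum_mul_pow (y n : ℕ) :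
    ∫ φ in (-Real.pi)..Real.pi, dirichletSum y (unitCircle φ) * unitCircle φ ^ n =
      2 * Real.pi * (((Set.Iic y).indicator (fun _ => (1 : ℝ)) n : ℝ) : ℂ) := by
  have e : ∀ φ : ℝ, dirichletSum y (unitCircle φ) * unitCircle φ ^ n =
      ∑ k ∈ Finset.range (y + 1), Complex.exp ((((n : ℤ) - k : ℤ) * Complex.I) * φ) := by
    intro φ
    rw [dirichletSum, Finset.sum_mul]
    refine Finset.sum_congr rfl fun k _ => ?_
    rw [unitCircle, ← Complex.exp_neg, ← Complex.exp_nat_mul, ← Complex.exp_nat_mul,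
      ← Complex.exp_add]
    congr 1
    push_cast
    ring
  simp_rw [e]
  rw [intervalIntegral.integral_finsetSum fun k _ =>
    (Continuous.intervalIntegrable (by fun_prop) _ _)]
  simp_rw [integral_exp_int_mul_I, sub_eq_zero, Nat.cast_inj]
  rw [Finset.sum_ite_eq]
  simp [Set.indicator]
  split_ifs <;> simp

/-! ### Generating function of the compound Poisson law -/

lemma measurable_randomSum :
    Measurable fun q : ℕ × (ℕ → ℕ) => ∑ i ∈ Finset.range q.1, q.2 i :=
  measurable_from_prod_countable_right fun n =>
    Finset.measurable_sum (Finset.range n) fun i _ => measurable_pi_apply i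

instance isProbabilityMeasure_compoundPoisson (lam : ℝ≥0) (μ : PMF ℕ) :
    IsProbabilityMeasure (compoundPoisson lam μ) :=
  Measure.isProbabilityMeasure_map measurable_randomSum.aemeasurable

lemma integrable_pow_of_norm_le_one {ν : Measure ℕ} [IsFiniteMeasure ν] {z : ℂ} (hz : ‖z‖ ≤ 1) :
    Integrable (fun n : ℕ => z ^ n) ν :=
  Integrable.of_bound (C := 1) .of_discrete (.of_forall fun n => by
    rw [norm_pow]; exact pow_le_one₀ (norm_nonneg _) hz)

lemma integral_pow_sum_infinitePi (μ : PMF ℕ) (z : ℂ) (n : ℕ) :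
    ∫ ω, z ^ (∑ i ∈ Finset.range n, ω i) ∂(Measure.infinitePi fun _ : ℕ => μ.toMeasure) =
      (∫ k, z ^ k ∂μ.toMeasure) ^ n := by
  have hind : iIndepFun (fun (i : ℕ) (ω : ℕ → ℕ) => ω i)
      (Measure.infinitePi fun _ : ℕ => μ.toMeasure) :=
    iIndepFun_infinitePi (P := fun _ : ℕ => μ.toMeasure) (X := fun _ k => k)
      fun _ => measurable_id
  have h := (hind.precomp (Fin.val_injective (n := n))).integral_fun_prod_comp
    (f := fun _ k => z ^ k) (fun i => (measurable_pi_apply _).aemeasurable)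
    (fun i => .of_discrete)
  simp_rw [Finset.prod_pow_eq_pow_sum] at h
  simp_rw [Finset.sum_range]
  rw [h]
  have h1 : ∀ i : ℕ, ∫ ω, z ^ (ω i) ∂(Measure.infinitePi fun _ : ℕ => μ.toMeasure) =
      ∫ k, z ^ k ∂μ.toMeasure := by
    intro i
    have hi := Measure.infinitePi_map_eval (fun _ : ℕ => μ.toMeasure) i
    conv_rhs => rw [← hi]
    exact (integral_map (measurable_pi_apply i).aemeasurable .of_discrete).symm
  simp [h1]

lemma summable_pmf_toReal (μ : PMF ℕ) : Summable fun j => (μ j).toReal :=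
  ENNReal.summable_toReal μ.tsum_coe_ne_top

lemma genFun_cpRate (lam : ℝ≥0) (μ : PMF ℕ) {z : ℂ} (hz : ‖z‖ ≤ 1) :
    genFun (cpRate lam μ) z = (lam : ℝ) * ∫ k, z ^ k ∂μ.toMeasure := by
  rw [PMF.integral_eq_tsum μ _ (integrable_pow_of_norm_le_one hz), genFun, ← tsum_mul_left]
  refine tsum_congr fun j => ?_
  rw [cpRate, Complex.real_smul]
  push_cast
  ring

lemma integral_pow_compoundPoisson (lam : ℝ≥0) (μ : PMF ℕ) {z : ℂ} (hz : ‖z‖ ≤ 1) :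
    ∫ n, z ^ n ∂(compoundPoisson lam μ) =
      Complex.exp (genFun (cpRate lam μ) z - genFun (cpRate lam μ) 1) := by
  have hint : Integrable (fun q : ℕ × (ℕ → ℕ) => z ^ ∑ i ∈ Finset.range q.1, q.2 i)
      ((poissonMeasure lam).prod (Measure.infinitePi fun _ : ℕ => μ.toMeasure)) :=
    (integrable_pow_of_norm_le_one (ν := compoundPoisson lam μ) hz).comp_measurable
      measurable_randomSum
  rw [compoundPoisson, integral_map measurable_randomSum.aemeasurable .of_discrete,
    integral_prod _ hint]
  simp_rw [integral_pow_sum_infinitePi]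
  rw [integral_poissonMeasure, genFun_cpRate lam μ hz, genFun_cpRate lam μ (by simp)]
  set m := ∫ k, z ^ k ∂μ.toMeasure
  have h := (NormedSpace.expSeries_div_hasSum_exp (((lam : ℝ) : ℂ) * m)).mul_left
    (Complex.exp (-(lam : ℝ)))
  rw [← Complex.exp_eq_exp_ℂ, ← Complex.exp_add] at h
  convert! h.tsum_eq using 1
  · refine tsum_congr fun n => ?_
    rw [Complex.real_smul, mul_pow]
    push_cast
    ring
  · congr 1
    simp
    ring

lemma integral_indicator_compoundPoisson (lam : ℝ≥0) (μ : PMF ℕ) (y : ℕ) :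
    ∫ φ in (-Real.pi)..Real.pi, dirichletSum y (unitCircle φ) *
        Complex.exp (genFun (cpRate lam μ) (unitCircle φ) - genFun (cpRate lam μ) 1) =
      2 * Real.pi * ((∫ n, (Set.Iic y).indicator (fun _ => (1 : ℝ)) n ∂(compoundPoisson lam μ) :
        ℝ) : ℂ) := by
  simp_rw [← integral_pow_compoundPoisson lam μ (norm_unitCircle _).le, ← integral_const_mul]
  rw [intervalIntegral_integral_swap]
  · simp_rw [integral_dirichletSum_mul_pow]
    rw [integral_const_mul, integral_complex_ofReal]
  · have : IsFiniteMeasure ((volume : Measure ℝ).restrict (Set.uIoc (-Real.pi) Real.pi)) :=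
      isFiniteMeasure_restrict.2 measure_Ioc_lt_top.ne
    refine Integrable.of_bound (C := y + 1) (Measurable.aestronglyMeasurable ?_)
      (.of_forall fun p => ?_)
    · refine measurable_from_prod_countable_left fun n => Continuous.measurable ?_
      exact (continuous_dirichletSum y).mul (continuous_unitCircle.pow n)
    · simpa [Function.uncurry, norm_unitCircle] using norm_dirichletSum_le y p.1

/-! ### Moments of the rates -/

lemma cpRate_nonneg (lam : ℝ≥0) (μ : PMF ℕ) (j : ℕ) : 0 ≤ cpRate lam μ j :=
  mul_nonneg lam.coe_nonneg ENNReal.toReal_nonneg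

lemma summable_cpRate (lam : ℝ≥0) (μ : PMF ℕ) : Summable (cpRate lam μ) :=
  (summable_pmf_toReal μ).mul_left _

lemma cast_descFactorial_two (j : ℕ) : (j.descFactorial 2 : ℝ) = j * (j - 1) := by
  rw [Nat.cast_descFactorial_two]

lemma summable_mul_cpRate {lam : ℝ≥0} {μ : PMF ℕ}
    (hfin : Summable fun j : ℕ => (j.descFactorial 2 : ℝ) * cpRate lam μ j) :
    Summable fun j : ℕ => (j : ℝ) * cpRate lam μ j := by
  refine ((summable_cpRate lam μ).add hfin).of_nonneg_of_le
    (fun j => mul_nonneg j.cast_nonneg (cpRate_nonneg lam μ j)) fun j => ?_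
  rw [cast_descFactorial_two]
  -- `j ≤ 1 + j(j-1)` is `(j-1)² ≥ 0`.
  nlinarith [mul_nonneg (sq_nonneg ((j : ℝ) - 1)) (cpRate_nonneg lam μ j)]

lemma hasSum_two_mul_cpTheta_sub {lam : ℝ≥0} {μ : PMF ℕ}
    (hfin : Summable fun j : ℕ => (j.descFactorial 2 : ℝ) * cpRate lam μ j) :
    HasSum (fun j : ℕ => (j : ℝ) * (2 * j - 3) * cpRate lam μ j)
      (2 * cpTheta lam μ 1 - cpTheta lam μ 0) := by
  have h0 : HasSum (fun j : ℕ => (j : ℝ) * cpRate lam μ j) (cpTheta lam μ 0) := by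
    simpa [cpTheta] using (summable_mul_cpRate hfin).hasSum
  convert! (hfin.hasSum.mul_left 2).sub h0 using 1
  ext j
  rw [cast_descFactorial_two]
  ring

/-! ### The bounded solution for `I(· ≤ y)` -/

/-- The Fourier representation of the solution of the Stein equation for `I(· ≤ y)`. -/
noncomputable def fourierSteinSolution (a : ℕ → ℝ) (y x : ℕ) : ℝ :=
  if x = 0 then 0 else
    (2 * Real.pi)⁻¹ * (∫ φ in (-Real.pi)..Real.pi,
      dirichletSum y (unitCircle φ) * steinTransform a (x - 1) (unitCircle φ)).re

section
variable {a : ℕ → ℝ} (ha : ∀ j, 0 ≤ a j) (hs : Summable a)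
  {t : ℝ} (ht : HasSum (fun j : ℕ => (j : ℝ) * (2 * j - 3) * a j) t) (ht0 : 0 ≤ t)
include ha hs ht ht0

/-- The factor `1-z` of the transform cancels the growth of the kernel near `z = 1`, making the
bound uniform in `y`. -/
lemma norm_dirichletSum_mul_steinTransform_le (y x : ℕ) (φ : ℝ) :
    ‖dirichletSum y (unitCircle φ) * steinTransform a x (unitCircle φ)‖ ≤
      2 * Real.exp (t / 2) := by
  have h1 := norm_steinTransform_le ha hs ht ht0 (norm_unitCircle φ) x
  have h2 := norm_geom_sum_inv_mul_le (norm_unitCircle φ) (y + 1)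
  rw [norm_mul] at h2 ⊢
  refine (mul_le_mul_of_nonneg_left h1 (norm_nonneg _)).trans ?_
  rw [← mul_assoc]
  exact mul_le_mul_of_nonneg_right h2 (Real.exp_nonneg _)

lemma abs_fourierSteinSolution_le (y x : ℕ) :
    |fourierSteinSolution a y x| ≤ 2 * Real.exp (t / 2) := by
  unfold fourierSteinSolution
  split_ifs
  · simp
    positivity
  · have h := intervalIntegral.norm_integral_le_of_norm_le_const (a := -Real.pi) (b := Real.pi)
      fun φ _ => norm_dirichletSum_mul_steinTransform_le ha hs ht ht0 y (x - 1) φ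
    have h2 := (Complex.abs_re_le_norm _).trans h
    have hpi := Real.pi_pos
    rw [sub_neg_eq_add, ← two_mul, abs_of_pos (by positivity : 0 < 2 * Real.pi)] at h2
    rw [abs_mul, abs_of_pos (by positivity : 0 < (2 * Real.pi)⁻¹), inv_mul_le_iff₀ (by positivity)]
    linarith

lemma hasSum_fourierSteinSolution (hs1 : Summable fun j : ℕ => (j : ℝ) * a j) (y x : ℕ) :
    HasSum (fun j : ℕ => (j : ℝ) * a j * fourierSteinSolution a y (x + j))
      ((Set.Iic y).indicator (fun _ => (1 : ℝ)) x - (2 * Real.pi)⁻¹ *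
        (∫ φ in (-Real.pi)..Real.pi, dirichletSum y (unitCircle φ) *
          Complex.exp (genFun a (unitCircle φ) - genFun a 1)).re +
        x * fourierSteinSolution a y x) := by
  have hK := continuous_dirichletSum y
  have hT : ∀ k, Continuous fun φ => steinTransform a k (unitCircle φ) :=
    continuous_steinTransform_comp ha hs continuous_unitCircle norm_unitCircle
  have hG : Continuous fun φ => Complex.exp (genFun a (unitCircle φ) - genFun a 1) := by
    have := continuous_genFun_comp ha hs continuous_unitCircle fun φ => (norm_unitCircle φ).le
    fun_prop
  have hsum := hasSum_intervalIntegral_mul_of_bounded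
    (fun j : ℕ => (mul_nonneg j.cast_nonneg (ha j) : 0 ≤ (j : ℝ) * a j)) hs1
    (g := fun j φ => dirichletSum y (unitCircle φ) * steinTransform a (x + j - 1) (unitCircle φ))
    (fun j => hK.mul (hT _))
    (fun j φ => norm_dirichletSum_mul_steinTransform_le ha hs ht ht0 y _ φ) (-Real.pi) Real.pi
  have hpt : ∀ φ : ℝ, ∑' j : ℕ, ((j * a j : ℝ) : ℂ) *
        (dirichletSum y (unitCircle φ) * steinTransform a (x + j - 1) (unitCircle φ)) =
      dirichletSum y (unitCircle φ) * unitCircle φ ^ x - dirichletSum y (unitCircle φ) *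
          Complex.exp (genFun a (unitCircle φ) - genFun a 1) +
        x * (dirichletSum y (unitCircle φ) * steinTransform a (x - 1) (unitCircle φ)) := by
    intro φ
    have h := (hasSum_steinTransform ha hs ht ht0 hs1 (norm_unitCircle φ) x).mul_left
      (dirichletSum y (unitCircle φ))
    convert! h.tsum_eq using 1
    · exact tsum_congr fun j => by ring
    · ring
  have hi : ∀ {g : ℝ → ℂ}, Continuous g → IntervalIntegrable g volume (-Real.pi) Real.pi :=
    fun hg => hg.intervalIntegrable _ _
  have hpow : Continuous fun φ => dirichletSum y (unitCircle φ) * unitCircle φ ^ x :=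
    hK.mul (continuous_unitCircle.pow x)
  have hKG : Continuous fun φ => dirichletSum y (unitCircle φ) *
      Complex.exp (genFun a (unitCircle φ) - genFun a 1) := hK.mul hG
  have hsub : Continuous fun φ => dirichletSum y (unitCircle φ) * unitCircle φ ^ x -
      dirichletSum y (unitCircle φ) * Complex.exp (genFun a (unitCircle φ) - genFun a 1) :=
    hpow.sub hKG
  have hKT : Continuous fun φ => (x : ℂ) *
      (dirichletSum y (unitCircle φ) * steinTransform a (x - 1) (unitCircle φ)) :=
    (hK.mul (hT (x - 1))).const_mul _
  simp_rw [hpt] at hsum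
  rw [intervalIntegral.integral_add (hi hsub) (hi hKT),
    intervalIntegral.integral_sub (hi hpow) (hi hKG), integral_dirichletSum_mul_pow,
    intervalIntegral.integral_const_mul] at hsum
  have hre := (Complex.hasSum_re hsum).mul_left (2 * Real.pi)⁻¹
  have hpi := Real.pi_ne_zero
  convert! hre using 1
  · ext j
    rw [Complex.re_ofReal_mul, fourierSteinSolution]
    split_ifs with h
    -- The convention `f 0 = 0` is harmless: the value at 0 enters only with coefficient `j = 0`.
    · have : j = 0 := by omega
      simp [this]
    · ring
  · have e : ((x : ℂ) * ∫ φ in (-Real.pi)..Real.pi,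
        dirichletSum y (unitCircle φ) * steinTransform a (x - 1) (unitCircle φ)).re =
        x * (∫ φ in (-Real.pi)..Real.pi,
        dirichletSum y (unitCircle φ) * steinTransform a (x - 1) (unitCircle φ)).re := by
      rw [← Complex.ofReal_natCast, Complex.re_ofReal_mul]
    have e2 : (2 * (Real.pi : ℂ) * (((Set.Iic y).indicator (fun _ => (1 : ℝ)) x : ℝ) : ℂ)).re =
        2 * Real.pi * (Set.Iic y).indicator (fun _ => (1 : ℝ)) x := by
      rw [← Complex.ofReal_ofNat, ← Complex.ofReal_mul, Complex.re_ofReal_mul, Complex.ofReal_re]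
    rw [Complex.add_re, Complex.sub_re, e, e2, fourierSteinSolution]
    split_ifs with h
    · simp [h]
      field_simp
    · field_simp

end

lemma isSteinSolution_fourierSteinSolution {lam : ℝ≥0} {μ : PMF ℕ}
    (hfin : Summable fun j : ℕ => (j.descFactorial 2 : ℝ) * cpRate lam μ j)
    (hθ : cpTheta lam μ 0 ≤ 2 * cpTheta lam μ 1) (y : ℕ) :
    IsSteinSolution lam μ ((Set.Iic y).indicator fun _ => (1 : ℝ))
      (fourierSteinSolution (cpRate lam μ) y) := by
  have h := hasSum_fourierSteinSolution (cpRate_nonneg lam μ) (summable_cpRate lam μ)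
    (hasSum_two_mul_cpTheta_sub hfin) (sub_nonneg.2 hθ) (summable_mul_cpRate hfin) y
  refine ⟨by simp [fourierSteinSolution], ⟨_, abs_fourierSteinSolution_le (cpRate_nonneg lam μ)
    (summable_cpRate lam μ) (hasSum_two_mul_cpTheta_sub hfin) (sub_nonneg.2 hθ) y⟩,
    fun x => (h x).summable, fun x => ?_⟩
  have hpi := Real.pi_ne_zero
  rw [(h x).tsum_eq, integral_indicator_compoundPoisson, ← Complex.ofReal_ofNat,
    ← Complex.ofReal_mul, Complex.re_ofReal_mul, Complex.ofReal_re]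
  field_simp
  ring

/-! ### Uniqueness of the bounded solution -/

/-- Once `x` exceeds `2 ∑ c_j`, the equation halves any bound on the tail of `g`, so the tail
vanishes. Since `c 0 = 0`, the value at `x ≥ 1` depends only on later ones, and zeros propagate
downwards. -/
lemma eq_zero_of_bounded_of_forall_tsum_eq {c : ℕ → ℝ} (hc : ∀ j, 0 ≤ c j) (hc0 : c 0 = 0)
    (hs : Summable c) {g : ℕ → ℝ} (hg0 : g 0 = 0) (hg : ∃ C, ∀ x, |g x| ≤ C)
    (h : ∀ x : ℕ, ∑' j, c j * g (x + j) = x * g x) : g = 0 := by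
  obtain ⟨C, hC⟩ := hg
  have step : ∀ (m : ℕ) (B : ℝ), (∀ x, m ≤ x → |g x| ≤ B) → ∀ x, m ≤ x + 1 →
      (x : ℝ) * |g x| ≤ (∑' j, c j) * B := by
    intro m B hB x hx
    have hb : ∀ j, ‖c j * g (x + j)‖ ≤ c j * B := by
      intro j
      rcases Nat.eq_zero_or_pos j with rfl | hj
      · simp [hc0]
      · rw [norm_mul, Real.norm_of_nonneg (hc j)]
        exact mul_le_mul_of_nonneg_left (hB _ (by omega)) (hc j)
    have := tsum_of_norm_bounded (hs.hasSum.mul_right B) hb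
    rwa [h, norm_mul, Real.norm_of_nonneg x.cast_nonneg, Real.norm_eq_abs] at this
  have hS : 0 ≤ ∑' j, c j := tsum_nonneg hc
  obtain ⟨m, hm⟩ := exists_nat_gt (2 * ∑' j, c j)
  have hhalf : ∀ B, (∀ x, m ≤ x → |g x| ≤ B) → ∀ x, m ≤ x → |g x| ≤ 1 / 2 * B := by
    intro B hB x hx
    have h1 := step m B hB x (by omega)
    have h2 : (m : ℝ) ≤ x := by exact_mod_cast hx
    have hB0 : 0 ≤ B := (abs_nonneg _).trans (hB x hx)
    have hx0 : (0 : ℝ) < x := by linarith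
    refine le_of_mul_le_mul_left ?_ hx0
    nlinarith
  have hpow : ∀ k : ℕ, ∀ x, m ≤ x → |g x| ≤ (1 / 2) ^ k * C := by
    intro k
    induction k with
    | zero => intro x _; simpa using hC x
    | succ k ih =>
      intro x hx
      have := hhalf _ ih x hx
      rw [pow_succ]
      linarith
  have htail : ∀ x, m ≤ x → g x = 0 := by
    intro x hx
    have hlim : Filter.Tendsto (fun k : ℕ => (1 / 2 : ℝ) ^ k * C) Filter.atTop (nhds (0 * C)) :=
      (tendsto_pow_atTop_nhds_zero_of_lt_one (by norm_num) (by norm_num)).mul_const C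
    rw [zero_mul] at hlim
    exact abs_eq_zero.1 (le_antisymm (ge_of_tendsto' hlim fun k => hpow k x hx) (abs_nonneg _))
  have hdown : ∀ k, ∀ x, m ≤ x + k → g x = 0 := by
    intro k
    induction k with
    | zero => simpa using htail
    | succ k ih =>
      intro x hx
      rcases Nat.eq_zero_or_pos x with rfl | hx0
      · exact hg0
      · have h1 := step (x + 1) 0 (fun y hy => by rw [ih y (by omega), abs_zero]) x le_rfl
        have hx1 : (0 : ℝ) < x := by exact_mod_cast hx0
        rw [mul_zero] at h1
        exact abs_eq_zero.1 (le_antisymm (nonpos_of_mul_nonpos_right h1 hx1) (abs_nonneg _))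
  ext x
  exact hdown m x (by omega)

lemma IsSteinSolution.unique {lam : ℝ≥0} {μ : PMF ℕ} {h f g : ℕ → ℝ}
    (hs : Summable fun j : ℕ => (j : ℝ) * cpRate lam μ j)
    (hf : IsSteinSolution lam μ h f) (hg : IsSteinSolution lam μ h g) : f = g := by
  refine sub_eq_zero.1 (eq_zero_of_bounded_of_forall_tsum_eq
    (c := fun j : ℕ => (j : ℝ) * cpRate lam μ j)
    (fun j => mul_nonneg j.cast_nonneg (cpRate_nonneg lam μ j)) (by simp) hs
    (by simp [hf.zero, hg.zero]) ?_ fun x => ?_)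
  · obtain ⟨C, hC⟩ := hf.bounded
    obtain ⟨D, hD⟩ := hg.bounded
    exact ⟨C + D, fun x => (abs_sub _ _).trans (add_le_add (hC x) (hD x))⟩
  · have h1 := hf.stein x
    have h2 := hg.stein x
    simp only [Pi.sub_apply, mul_sub]
    rw [(hf.summable x).tsum_sub (hg.summable x)]
    linarith

/-! ### Comparison with the stated bounds -/

lemma abs_steinSolution_le {lam : ℝ≥0} {μ : PMF ℕ}
    (hfin : Summable fun j : ℕ => (j.descFactorial 2 : ℝ) * cpRate lam μ j)
    (hθ : cpTheta lam μ 0 ≤ 2 * cpTheta lam μ 1) {h : ℕ → ℝ} (hh : h ∈ kolmogorovClass) (x : ℕ) :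
    |steinSolution lam μ h x| ≤
      2 * Real.exp ((2 * cpTheta lam μ 1 - cpTheta lam μ 0) / 2) := by
  obtain ⟨y, rfl⟩ := hh
  have hF := isSteinSolution_fourierSteinSolution hfin hθ y
  rw [steinSolution, (Classical.epsilon_spec (p := IsSteinSolution lam μ _) ⟨_, hF⟩).unique
    (summable_mul_cpRate hfin) hF]
  exact abs_fourierSteinSolution_le (cpRate_nonneg lam μ) (summable_cpRate lam μ)
    (hasSum_two_mul_cpTheta_sub hfin) (sub_nonneg.2 hθ) y x

lemma two_mul_exp_half_le {t δ : ℝ} (ht : 0 < t)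
    (hδ : δ = t / (2 * Real.sqrt Real.pi * Real.exp ((3 / 2) * t))) :
    2 * Real.exp (t / 2) ≤ 2 * Real.sqrt (2 / δ) := by
  have hpi : 1 ≤ Real.sqrt Real.pi := Real.one_le_sqrt.2 (by linarith [Real.pi_gt_three])
  refine mul_le_mul_of_nonneg_left (Real.le_sqrt_of_sq_le ?_) zero_le_two
  have e : 2 / δ = 4 * Real.sqrt Real.pi * Real.exp ((3 / 2) * t) / t := by
    rw [hδ]
    field_simp
    norm_num
  rw [e, le_div_iff₀ ht, ← Real.exp_nat_mul]
  have e2 : Real.exp ((3 / 2) * t) = Real.exp ((2 : ℕ) * (t / 2)) * Real.exp (t / 2) := by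
    rw [← Real.exp_add]
    congr 1
    push_cast
    ring
  have h := Real.add_one_le_exp (t / 2)
  rw [e2]
  -- The claim reduces to this after squaring and cancelling `exp t`; it follows from `1 + t/2 ≤
  -- exp(t/2)`.
  have h3 : t ≤ 4 * Real.sqrt Real.pi * Real.exp (t / 2) := by nlinarith
  nlinarith [Real.exp_pos ((2 : ℕ) * (t / 2))]

lemma four_mul_exp_half_le {t δ : ℝ} (ht : 0 < t)
    (hδ : δ = t / (2 * Real.sqrt Real.pi * Real.exp ((3 / 2) * t))) :
    4 * Real.exp (t / 2) ≤ 1 / (2 * δ) := by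
  have hpi : 1.77 ≤ Real.sqrt Real.pi := Real.le_sqrt_of_sq_le (by linarith [Real.pi_gt_d2])
  have e : 1 / (2 * δ) = Real.sqrt Real.pi * Real.exp ((3 / 2) * t) / t := by
    rw [hδ]
    field_simp
  have e2 : Real.exp ((3 / 2) * t) = Real.exp (t / 2) * (Real.exp 1 * Real.exp (t - 1)) := by
    rw [← Real.exp_add, ← Real.exp_add]
    congr 1
    ring
  -- What is needed is `4t ≤ √π exp t`. The tangent at `t = 1` gives `exp t ≥ e t`, and `1.77 * 2.7
  -- > 4`.
  have h := Real.add_one_le_exp (t - 1)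
  have h1 : 2.7 ≤ Real.exp 1 := by linarith [Real.exp_one_gt_d9]
  have h2 : 2.7 * t ≤ Real.exp 1 * Real.exp (t - 1) :=
    mul_le_mul h1 (by linarith) ht.le (Real.exp_nonneg _)
  have h3 : 4 * t ≤ Real.sqrt Real.pi * (Real.exp 1 * Real.exp (t - 1)) := by nlinarith
  rw [e, le_div_iff₀ ht, e2]
  nlinarith [Real.exp_pos (t / 2)]

theorem theorem6 (lam : ℝ≥0) (μ : PMF ℕ) (hμ : μ 0 = 0)
    (hfin : Summable fun j : ℕ => (j.descFactorial 2 : ℝ) * cpRate lam μ j)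
    (hθ : cpTheta lam μ 0 < 2 * cpTheta lam μ 1)
    (δ : ℝ)
    (hδ : δ = (2 * cpTheta lam μ 1 - cpTheta lam μ 0) /
      (2 * Real.sqrt Real.pi *
        Real.exp ((3 / 2) * (2 * cpTheta lam μ 1 - cpTheta lam μ 0)))) :
    (∀ h ∈ kolmogorovClass, ∃! f : ℕ → ℝ, IsSteinSolution lam μ h f) ∧
    steinFactorK 0 lam μ ≤ ENNReal.ofReal (2 * Real.sqrt (2 / δ)) ∧
    steinFactorK 1 lam μ ≤
      ENNReal.ofReal (1 / (2 * δ) * (1 + Real.posLog (Real.pi * δ))) := by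
  have ht := sub_pos.2 hθ
  have hδ0 : 0 < δ := by
    rw [hδ]
    positivity
  refine ⟨?_, ?_, ?_⟩
  · rintro _ ⟨y, rfl⟩
    have hF := isSteinSolution_fourierSteinSolution hfin hθ.le y
    exact ⟨_, hF, fun g hg => hg.unique (summable_mul_cpRate hfin) hF⟩
  · refine iSup₂_le fun h hh => iSup_le fun x => ENNReal.ofReal_le_ofReal ?_
    exact (abs_steinSolution_le hfin hθ.le hh x).trans (two_mul_exp_half_le ht hδ)
  · refine iSup₂_le fun h hh => iSup_le fun x => ENNReal.ofReal_le_ofReal ?_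
    have h1 := abs_steinSolution_le hfin hθ.le hh x
    have h2 := abs_steinSolution_le hfin hθ.le hh (x + 1)
    have h3 := abs_sub (steinSolution lam μ h (x + 1)) (steinSolution lam μ h x)
    have h4 := four_mul_exp_half_le ht hδ
    -- Of the logarithmic term only its nonnegativity matters.
    have h5 : 1 / (2 * δ) ≤ 1 / (2 * δ) * (1 + Real.posLog (Real.pi * δ)) :=
      le_mul_of_one_le_right (by positivity) (by linarith [Real.posLog_nonneg (x := Real.pi * δ)])
    simp only [Function.iterate_one, fwdDiff]
    linarith
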